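/- All graphs are finite and simple. A subdivision of a graph $F$ is a graph obtained from $F$ by replacing its edges by pairwise internally vertex-disjoint paths between their end-vertices (a path may be a single edge). Two subgraphs of a graph $G$ are distinguishable if their vertex sets differ, and $s(F,G)$ denotes the size of the largest collection of pairwise distinguishable subgraphs of $G$ that are subdivisions of $F$. A copy of $F'$ in $G$ is a subgraph of $G$ isomorphic to $F'$. For integers $k,t$, a graph $G$ is $(F,k,t)$-locally dense if, for every subgraph $F'$ of $F$ with at least $k$ vertices and at least one edge, every edge of $G$ lies in at least $t$ copies of $F'$. Let $s_t(F,k)$ be the minimum of $s(F,G)$ over all $(F,k,t)$-locally dense graphs $G$ with at least one edge. Theorem. For every integer $k\ge 3$ there is a real number $c'(k)\ge\frac{1}{2(k-2)}$ such that for every integer $\ell\ge k$ the following hold for all sufficiently large integers $t$ (depending on $k$ and $\ell$) and all graphs $F$ on $\ell$ vertices. There is at least one $(F,k,t)$-locally dense graph with at least one edge, so that $s_t(F,k)$ is well defined, and (i) if $F$ contains a copy of $K_k$, then $s_t(F,k)\ge 2^{t^{c'(k)}}$; (ii) if $F$ is $K_k$-free, then $s_t(F,k)\le 2^{\ell}(t+2)^{e(F)+2\ell}$,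 where $e(F)$ is the number of edges of $F$. -/

import Mathlib

open Filter

namespace LocallyDense

variable {V W : Type*}

/-- The subgraph `T` of `G` is a subdivision of `F`: there are distinct branch vertices `b w`, one
for each vertex `w` of `F`, and for each edge `uv` of `F` a path `P u v` in `G` from `b u` to `b v`
(`P v u` is the same path traversed backwards), such that the paths are pairwise internally
vertex-disjoint and have no branch vertex in their interiors, and `T` consists exactly of the
branch vertices and these paths. -/
def IsSubdivision (F : SimpleGraph W) {G : SimpleGraph V} (T : G.Subgraph) : Prop :=
  ∃ (b : W ↪ V) (P : ∀ u v : W, F.Adj u v → G.Walk (b u) (b v)),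
    (∀ u v (h : F.Adj u v), (P u v h).IsPath) ∧
    (∀ u v (h : F.Adj u v), P v u h.symm = (P u v h).reverse) ∧
    (∀ u v (h : F.Adj u v) (w : W), b w ∈ (P u v h).support → w = u ∨ w = v) ∧
    (∀ u v (h : F.Adj u v) u' v' (h' : F.Adj u' v'), s(u, v) ≠ s(u', v') →
      ∀ x ∈ (P u v h).support, x ∈ (P u' v' h').support → x ∈ Set.range b) ∧
    (∀ x : V, x ∈ T.verts ↔
      x ∈ Set.range b ∨ ∃ u v, ∃ h : F.Adj u v, x ∈ (P u v h).support) ∧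
    (∀ x y : V, T.Adj x y ↔ ∃ u v, ∃ h : F.Adj u v, s(x, y) ∈ (P u v h).edges)

/-- Two subgraphs of `G` are distinguishable if they have different vertex sets. -/
def Distinguishable {G : SimpleGraph V} (H H' : G.Subgraph) : Prop :=
  H.verts ≠ H'.verts

/-- `s(F, G)`: the size of the largest collection of (pairwise) distinguishable subdivisions of `F`
in the finite graph `G`. -/
noncomputable def subdivisionCount (F : SimpleGraph W) (G : SimpleGraph V) : ℕ :=
  sSup {n : ℕ | ∃ C : Finset G.Subgraph, (∀ T ∈ C, IsSubdivision F T) ∧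
    (C : Set G.Subgraph).Pairwise Distinguishable ∧ C.card = n}

/-- The copies of `F'` in `G` (subgraphs of `G` isomorphic to `F'`) that contain the edge `e`. -/
def copiesThrough (F' : SimpleGraph W) (G : SimpleGraph V) (e : Sym2 V) : Set G.Subgraph :=
  {H | e ∈ H.edgeSet ∧ Nonempty (F' ≃g H.coe)}

/-- `G` is `(F, k, t)`-locally dense: every edge of `G` lies in at least `t` copies of `F'`, for
every subgraph `F'` of `F` with at least `k` vertices. Subgraphs `F'` without edges are left out,
since no edge can lie in a copy of one. -/
def IsLocallyDense (F : SimpleGraph W) (k t : ℕ) (G : SimpleGraph V) : Prop :=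
  ∀ F' : F.Subgraph, k ≤ F'.verts.ncard → F'.edgeSet.Nonempty →
    ∀ e ∈ G.edgeSet, t ≤ (copiesThrough F'.coe G e).ncard

/-- The values `s(F, G)` for the finite `(F, k, t)`-locally dense graphs `G` with at least one edge
(up to isomorphism, the vertex set of a finite graph is `Fin n`). -/
def subdivisionCounts (F : SimpleGraph W) (k t : ℕ) : Set ℕ :=
  {m | ∃ (n : ℕ) (G : SimpleGraph (Fin n)),
    G.edgeSet.Nonempty ∧ IsLocallyDense F k t G ∧ subdivisionCount F G = m}

/-- `s_t(F, k)`: the minimum of `s(F, G)` over the `(F, k, t)`-locally dense graphs `G`. -/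
noncomputable def minSubdivisionCount (F : SimpleGraph W) (k t : ℕ) : ℕ :=
  sInf (subdivisionCounts F k t)

end LocallyDense

/-!
Both bounds come from explicit constructions; the lower bound holds with
`c' k = 1 / (2 * (k - 2))`.

**`F` contains `K_k`.** A copy of `K_k` through an edge `uv` of `G` is determined by its other
`k - 2` vertices, which are common neighbours of `u` and `v` (`ncard_copiesThrough_le`). Hence the
ends of every edge have `c` common neighbours with `t ≤ c ^ (k - 2)`. Also `G` contains a copy of
`F`, since `F` is a subgraph of itself with at least `k` vertices. A single edge `u₀v₀` of this copy
is replaced by a long path: choose a common neighbour `w` of `u₀` and `v₀`, then a common neighbour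
`w'` of `u₀` and `w`, go from `u₀` to `w` either directly or through `w'`, and continue in the same
way with the edge `wv₀`. Each round consumes two unused vertices and doubles the number of vertex
sets, so about `c / 2` rounds are possible (`exists_path_supports`), and each path gives a
subdivision of `F` whose vertex set determines the path (`two_pow_le_subdivisionCount`). As
`c ≥ (t ^ c' k) ^ 2`, there is ample room for `t ^ c' k` rounds when `t` is large.

**`F` is `K_k`-free.** Take the join of a clique on `ℓ` vertices with `t + 1` independent vertices
(`cliqueJoinIndep`). A subgraph of `F` with at least `k` vertices and an edge is not complete, so a
non-isolated vertex and a non-neighbour of it can be placed in the independent set and all other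
vertices in the clique. Moving one vertex through the independent set gives `t` copies through any
prescribed edge (`isLocallyDense_cliqueJoinIndep`). On the other hand the clique is a vertex cover
of size `ℓ`, so a path of a subdivision has at most one more interior vertex outside the clique than
inside. Hence a subdivision of `F` has at most `e(F) + 2ℓ` vertices outside the clique
(`ncard_verts_not_cover_le`), which leaves only polynomially many vertex sets.

For arbitrary `F` a large complete graph is locally dense (`isLocallyDense_top`), so the minimum is
taken over a nonempty set.
-/

namespace LocallyDense

variable {V W : Type*}

/-! ### Many paths between the ends of an edge -/

/-- If any two adjacent vertices have at least `s` common neighbours and `A.card + 2 * p ≤ s`, then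
the paths between two adjacent vertices `u, v ∈ A` whose interiors avoid `A` have at least `2 ^ p`
distinct vertex sets. -/
lemma exists_path_supports [Fintype V] [DecidableEq V] (G : SimpleGraph V) (s : ℕ)
    (hs : ∀ u v, G.Adj u v → s ≤ (G.commonNeighbors u v).ncard) (p : ℕ) :
    ∀ (u v : V) (A : Finset V), G.Adj u v → u ∈ A → v ∈ A → A.card + 2 * p ≤ s →
      ∃ C : Finset (Finset V), C.card = 2 ^ p ∧ ∀ S ∈ C, ∃ q : G.Walk u v, q.IsPath ∧
        q.support.toFinset = S ∧ ∀ x ∈ S, x ∈ A → x = u ∨ x = v := by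
  have pick : ∀ u v (A : Finset V), G.Adj u v → A.card < s →
      ∃ w, G.Adj u w ∧ G.Adj v w ∧ w ∉ A := by
    intro u v A huv hA
    have : ∃ w ∈ G.commonNeighbors u v, w ∉ (A : Set V) := by
      apply Set.exists_mem_notMem_of_ncard_lt_ncard _ A.finite_toSet
      rw [Set.ncard_coe_finset]
      exact hA.trans_le (hs u v huv)
    obtain ⟨w, ⟨h1, h2⟩, h3⟩ := this
    exact ⟨w, h1, h2, by simpa using h3⟩
  induction p with
  | zero =>
    intro u v A huv hu hv _
    refine ⟨{{u, v}}, by simp, ?_⟩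
    intro S hS
    rw [Finset.mem_singleton] at hS
    subst hS
    refine ⟨huv.toWalk, ?_, ?_, ?_⟩
    · simp [SimpleGraph.Adj.toWalk, huv.ne]
    · ext; simp [SimpleGraph.Adj.toWalk]
    · intro x hx _; simpa using hx
  | succ p ih =>
    intro u v A huv hu hv hA
    obtain ⟨w, huw, hvw, hwA⟩ := pick u v A huv (by omega)
    have hc1 : (insert w A).card = A.card + 1 := Finset.card_insert_of_notMem hwA
    obtain ⟨w', huw', hww', hw'A⟩ := pick u w (insert w A) huw (by omega)
    have hc2 : (insert w' (insert w A)).card = A.card + 2 := by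
      rw [Finset.card_insert_of_notMem hw'A, hc1]
    obtain ⟨C, hC, hCp⟩ := ih w v (insert w' (insert w A)) hvw.symm (by simp) (by simp [hv])
      (by omega)
    have hwv : w' ≠ v := fun h => hw'A (by simp [h, hv])
    have huS : ∀ S ∈ C, u ∉ S := by
      intro S hS hmem
      obtain ⟨q, -, -, h⟩ := hCp S hS
      rcases h u hmem (by simp [hu]) with h | h
      · exact huw.ne h
      · exact huv.ne h
    have hwS : ∀ S ∈ C, w' ∉ S := by
      intro S hS hmem
      obtain ⟨q, -, -, h⟩ := hCp S hS
      rcases h w' hmem (by simp) with h | h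
      · exact hww'.ne h.symm
      · exact hwv h
    have hi1 : Set.InjOn (fun S : Finset V => insert u S) C := by
      intro S hS S' hS' h
      rw [← Finset.erase_insert (huS S hS), ← Finset.erase_insert (huS S' hS')]
      exact congrArg (fun T => Finset.erase T u) h
    have hi2 : Set.InjOn (fun S : Finset V => insert w' (insert u S)) C := by
      intro S hS S' hS' h
      have h1 : w' ∉ insert u S := by simp [hwS S hS, huw'.ne']
      have h2 : w' ∉ insert u S' := by simp [hwS S' hS', huw'.ne']
      apply hi1 hS hS'
      change insert u S = insert u S'
      rw [← Finset.erase_insert h1, ← Finset.erase_insert h2]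
      exact congrArg (fun T => Finset.erase T w') h
    refine ⟨C.image (fun S => insert u S) ∪ C.image (fun S => insert w' (insert u S)), ?_, ?_⟩
    · rw [Finset.card_union_of_disjoint, Finset.card_image_of_injOn hi1,
        Finset.card_image_of_injOn hi2, hC]
      · ring
      · rw [Finset.disjoint_left]
        simp only [Finset.mem_image]
        rintro _ ⟨S, hS, rfl⟩ ⟨S', hS', h⟩
        have : w' ∈ insert u S := by rw [← h]; simp
        simp [hwS S hS, huw'.ne'] at this
    · intro S hS
      rw [Finset.mem_union, Finset.mem_image, Finset.mem_image] at hS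
      have hend : ∀ S ∈ C, ∀ x ∈ S, x ∈ A → x = u ∨ x = v := by
        intro S hS x hx hxA
        obtain ⟨q, -, -, h⟩ := hCp S hS
        rcases h x hx (by simp [hxA]) with h | h
        · exact absurd (h ▸ hxA) hwA
        · exact Or.inr h
      rcases hS with ⟨S, hS, rfl⟩ | ⟨S, hS, rfl⟩
      · obtain ⟨q, hq, rfl, -⟩ := hCp S hS
        refine ⟨.cons huw q, ?_, ?_, ?_⟩
        · exact (SimpleGraph.Walk.cons_isPath_iff _ _).2 ⟨hq, by simpa using huS _ hS⟩
        · simp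
        · intro x hx hxA
          rcases Finset.mem_insert.1 hx with h | h
          · exact Or.inl h
          · exact hend _ hS x h hxA
      · obtain ⟨q, hq, rfl, -⟩ := hCp S hS
        refine ⟨.cons huw' (.cons hww'.symm q), ?_, ?_, ?_⟩
        · have h1 := huS _ hS
          have h2 := hwS _ hS
          rw [List.mem_toFinset] at h1 h2
          simp only [SimpleGraph.Walk.cons_isPath_iff, SimpleGraph.Walk.support_cons,
            List.mem_cons, not_or]
          exact ⟨⟨hq, h2⟩, huw'.ne, h1⟩
        · ext; simp; tauto
        · intro x hx hxA
          rcases Finset.mem_insert.1 hx with h | h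
          · subst h; exact absurd (Finset.mem_insert_of_mem hxA) hw'A
          rcases Finset.mem_insert.1 h with h | h
          · exact Or.inl h
          · exact hend _ hS x h hxA

/-! ### Subdivisions with one subdivided edge -/

/-- Branch vertices and connecting paths as in `IsSubdivision` span a subdivision. -/
lemma exists_isSubdivision {F : SimpleGraph W} {G : SimpleGraph V} (b : W ↪ V)
    (P : ∀ u v : W, F.Adj u v → G.Walk (b u) (b v))
    (h1 : ∀ u v (h : F.Adj u v), (P u v h).IsPath)
    (h2 : ∀ u v (h : F.Adj u v), P v u h.symm = (P u v h).reverse)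
    (h3 : ∀ u v (h : F.Adj u v) (w : W), b w ∈ (P u v h).support → w = u ∨ w = v)
    (h4 : ∀ u v (h : F.Adj u v) u' v' (h' : F.Adj u' v'), s(u, v) ≠ s(u', v') →
      ∀ x ∈ (P u v h).support, x ∈ (P u' v' h').support → x ∈ Set.range b) :
    ∃ T : G.Subgraph, IsSubdivision F T ∧ T.verts = {x | x ∈ Set.range b ∨
      ∃ u v, ∃ h : F.Adj u v, x ∈ (P u v h).support} := by
  refine ⟨{ verts := {x | x ∈ Set.range b ∨ ∃ u v, ∃ h : F.Adj u v, x ∈ (P u v h).support}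
            Adj := fun x y => ∃ u v, ∃ h : F.Adj u v, s(x, y) ∈ (P u v h).edges
            adj_sub := ?_
            edge_vert := ?_
            symm := ?_ }, ⟨b, P, h1, h2, h3, h4, ?_, ?_⟩, rfl⟩
  · rintro x y ⟨u, v, h, hxy⟩
    exact (P u v h).adj_of_mem_edges hxy
  · rintro x y ⟨u, v, h, hxy⟩
    exact Or.inr ⟨u, v, h, (P u v h).fst_mem_support_of_mem_edges hxy⟩
  · constructor
    rintro x y ⟨u, v, h, hxy⟩
    exact ⟨u, v, h, by rwa [Sym2.eq_swap]⟩
  · intro x; rfl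
  · intro x y; rfl

/-- Replacing one edge `u₀v₀` of a copy of `F` by a path that is internally disjoint from the copy
gives a subdivision of `F`. -/
lemma exists_isSubdivision_of_path {F : SimpleGraph W} {G : SimpleGraph V}
    (f : SimpleGraph.Copy F G) {u₀ v₀ : W} (h₀ : F.Adj u₀ v₀) (q : G.Walk (f u₀) (f v₀))
    (hq : q.IsPath) (hqf : ∀ w, f w ∈ q.support → w = u₀ ∨ w = v₀) :
    ∃ T : G.Subgraph, IsSubdivision F T ∧ T.verts = Set.range f ∪ {x | x ∈ q.support} := by
  classical
  -- Both orientations of the edge `u₀v₀` have to be treated, since `IsSubdivision` asks for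
  -- `P v u` to be the reverse of `P u v`.
  let P : ∀ u v : W, F.Adj u v → G.Walk (f u) (f v) := fun u v h =>
    if h1 : u = u₀ ∧ v = v₀ then q.copy (by rw [h1.1]) (by rw [h1.2])
    else if h2 : u = v₀ ∧ v = u₀ then q.reverse.copy (by rw [h2.1]) (by rw [h2.2])
    else (f.toHom.map_adj h).toWalk
  have hP : ∀ u v (h : F.Adj u v),
      (s(u, v) = s(u₀, v₀) ∧ (P u v h).IsPath ∧ ∀ x, x ∈ (P u v h).support ↔ x ∈ q.support) ∨
      (s(u, v) ≠ s(u₀, v₀) ∧ (P u v h).IsPath ∧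
        ∀ x, x ∈ (P u v h).support ↔ x = f u ∨ x = f v) := by
    intro u v h
    by_cases h1 : u = u₀ ∧ v = v₀
    · left
      obtain ⟨rfl, rfl⟩ := h1
      simp [P, hq]
    by_cases h2 : u = v₀ ∧ v = u₀
    · left
      obtain ⟨rfl, rfl⟩ := h2
      have : ¬ (u = v ∧ v = u) := fun h' => h.ne h'.1
      simp [P, this, hq]
    · right
      refine ⟨?_, ?_, ?_⟩
      · rw [Ne, Sym2.eq_iff]; tauto
      · simp only [P, h1, h2, dif_neg, not_false_eq_true]
        simpa [SimpleGraph.Adj.toWalk] using (f.toHom.map_adj h).ne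
      · simp only [P, h1, h2, dif_neg, not_false_eq_true]
        simp [SimpleGraph.Adj.toWalk]
  have hends : ∀ u v (h : F.Adj u v) w, f w ∈ (P u v h).support → w = u ∨ w = v := by
    intro u v h w hw
    rcases hP u v h with ⟨he, -, hs⟩ | ⟨-, -, hs⟩
    · have := hqf w ((hs _).1 hw)
      rw [Sym2.eq_iff] at he
      rcases he with ⟨rfl, rfl⟩ | ⟨rfl, rfl⟩ <;> tauto
    · rcases (hs _).1 hw with h | h
      · exact Or.inl (f.injective h)
      · exact Or.inr (f.injective h)
  obtain ⟨T, hT, hTv⟩ := exists_isSubdivision (G := G) (F := F) f.toEmbedding P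
    (fun u v h => by rcases hP u v h with h | h <;> exact h.2.1)
    (by
      intro u v h
      by_cases h1 : u = u₀ ∧ v = v₀
      · obtain ⟨rfl, rfl⟩ := h1
        have : ¬ (v = u ∧ u = v) := fun h' => h.ne h'.2
        simp [P, this]
        rfl
      by_cases h2 : u = v₀ ∧ v = u₀
      · obtain ⟨rfl, rfl⟩ := h2
        have : ¬ (u = v ∧ v = u) := fun h' => h.ne h'.1
        simp only [P, this, dif_neg, not_false_eq_true, and_self, dif_pos]
        simp
        exact q.reverse_reverse.symm
      · have h1' : ¬ (v = v₀ ∧ u = u₀) := fun h' => h1 h'.symm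
        have h2' : ¬ (v = u₀ ∧ u = v₀) := fun h' => h2 h'.symm
        simp only [P, h1, h2, h1', h2', dif_neg, not_false_eq_true]
        rfl)
    hends
    (by
      intro u v h u' v' h' hne x hx hx'
      rcases hP u v h with ⟨he, -, hs⟩ | ⟨-, -, hs⟩
      · rcases hP u' v' h' with ⟨he', -, -⟩ | ⟨-, -, hs'⟩
        · exact absurd (he.trans he'.symm) hne
        · rcases (hs' x).1 hx' with h | h
          · exact ⟨u', h.symm⟩
          · exact ⟨v', h.symm⟩
      · rcases (hs x).1 hx with h | h
        · exact ⟨u, h.symm⟩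
        · exact ⟨v, h.symm⟩)
  refine ⟨T, hT, ?_⟩
  rw [hTv]
  ext x
  constructor
  · rintro (h | ⟨u, v, h, hx⟩)
    · exact Or.inl h
    · rcases hP u v h with ⟨-, -, hs⟩ | ⟨-, -, hs⟩
      · exact Or.inr ((hs x).1 hx)
      · rcases (hs x).1 hx with h | h
        · exact Or.inl ⟨u, h.symm⟩
        · exact Or.inl ⟨v, h.symm⟩
  · rintro (h | hx)
    · exact Or.inl h
    · refine Or.inr ⟨u₀, v₀, h₀, ?_⟩
      rcases hP u₀ v₀ h₀ with ⟨-, -, hs⟩ | ⟨hne, -⟩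
      · exact (hs x).2 hx
      · exact absurd rfl hne

/-! ### The lower bound -/

/-- Any collection of distinguishable subdivisions bounds `subdivisionCount` from below. The graph
is finite, so the supremum in `subdivisionCount` is not a junk value. -/
lemma card_le_subdivisionCount [Finite V] {F : SimpleGraph W} {G : SimpleGraph V}
    (C : Finset G.Subgraph) (hC : ∀ T ∈ C, IsSubdivision F T)
    (hd : (C : Set G.Subgraph).Pairwise Distinguishable) : C.card ≤ subdivisionCount F G := by
  have := Fintype.ofFinite G.Subgraph
  apply le_csSup
  · refine ⟨Fintype.card G.Subgraph, ?_⟩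
    rintro n ⟨C, -, -, rfl⟩
    exact Finset.card_le_univ C
  · exact ⟨C, hC, hd, rfl⟩

/-- If the ends of every edge have many common neighbours, then subdividing a single edge of a
copy of `F` already gives exponentially many vertex sets. -/
lemma two_pow_le_subdivisionCount [Fintype V] [Fintype W] {F : SimpleGraph W}
    {G : SimpleGraph V} (f : SimpleGraph.Copy F G) {u₀ v₀ : W} (h₀ : F.Adj u₀ v₀) (p : ℕ)
    (hs : ∀ u v, G.Adj u v → Fintype.card W + 2 * p ≤ (G.commonNeighbors u v).ncard) :
    2 ^ p ≤ subdivisionCount F G := by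
  classical
  let A : Finset V := Finset.univ.image f
  have hA : A.card = Fintype.card W := by
    exact Finset.card_image_of_injective _ f.injective
  have hfA : ∀ w, f w ∈ A := fun w => Finset.mem_image_of_mem _ (Finset.mem_univ w)
  obtain ⟨C, hC, hCp⟩ := exists_path_supports G _ hs p (f u₀) (f v₀) A (f.toHom.map_adj h₀)
    (hfA _) (hfA _) (by rw [hA])
  have hex : ∀ S ∈ C, ∃ T : G.Subgraph, IsSubdivision F T ∧
      T.verts = Set.range f ∪ (S : Set V) ∧ f u₀ ∈ S ∧ f v₀ ∈ S ∧
      ∀ x ∈ S, x ∈ Set.range f → x = f u₀ ∨ x = f v₀ := by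
    intro S hS
    obtain ⟨q, hq, rfl, hqA⟩ := hCp S hS
    obtain ⟨T, hT, hTv⟩ := exists_isSubdivision_of_path f h₀ q hq (by
      intro w hw
      rcases hqA (f w) (by simpa using hw) (hfA w) with h | h
      · exact Or.inl (f.injective h)
      · exact Or.inr (f.injective h))
    refine ⟨T, hT, ?_, by simp, by simp, ?_⟩
    · rw [hTv]; ext; simp
    · rintro x hx ⟨w, rfl⟩
      exact hqA _ hx (hfA w)
  choose! T hT hTv hTu hTv' hTe using hex
  -- A path is recovered from the vertex set of its subdivision: it meets the copy in its ends only.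
  have hinj : ∀ S ∈ C, ∀ S' ∈ C, (T S).verts = (T S').verts → S ⊆ S' := by
    intro S hS S' hS' h x hx
    have hx' : x ∈ (T S').verts := by rw [← h, hTv S hS]; exact Or.inr hx
    rw [hTv S' hS'] at hx'
    rcases hx' with hx' | hx'
    · rcases hTe S hS x hx hx' with rfl | rfl
      · exact hTu S' hS'
      · exact hTv' S' hS'
    · exact hx'
  have hinj' : ∀ S ∈ C, ∀ S' ∈ C, (T S).verts = (T S').verts → S = S' :=
    fun S hS S' hS' h => (hinj S hS S' hS' h).antisymm (hinj S' hS' S hS h.symm)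
  have hTinj : Set.InjOn T C := fun S hS S' hS' h => hinj' S hS S' hS' (by rw [h])
  rw [← hC, ← Finset.card_image_of_injOn hTinj]
  apply card_le_subdivisionCount
  · intro T' hT'
    obtain ⟨S, hS, rfl⟩ := Finset.mem_image.1 hT'
    exact hT S hS
  · intro T₁ hT₁ T₂ hT₂ hne h
    obtain ⟨S, hS, rfl⟩ := Finset.mem_image.1 (Finset.mem_coe.1 hT₁)
    obtain ⟨S', hS', rfl⟩ := Finset.mem_image.1 (Finset.mem_coe.1 hT₂)
    exact hne (by rw [hinj' S hS S' hS' h])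

/-- A copy of `K_k` through the edge `uv` is determined by its `k - 2` further vertices, all of
which are common neighbours of `u` and `v`. -/
lemma ncard_copiesThrough_le [Fintype V] {G : SimpleGraph V} {k : ℕ} {H : SimpleGraph W}
    (hH : Nonempty ((⊤ : SimpleGraph (Fin k)) ≃g H)) {u v : V} (huv : G.Adj u v) :
    (copiesThrough H G s(u, v)).ncard ≤ (G.commonNeighbors u v).ncard ^ (k - 2) := by
  classical
  let N : Finset V := (G.commonNeighbors u v).toFinset
  have hN : (G.commonNeighbors u v).ncard = N.card := Set.ncard_eq_toFinset_card' _
  have key : ∀ K ∈ copiesThrough H G s(u, v), K.Adj u v ∧ K.verts.ncard = k ∧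
      ∀ x ∈ K.verts, ∀ y ∈ K.verts, x ≠ y → K.Adj x y := by
    rintro K ⟨he, ⟨φ⟩⟩
    obtain ⟨ψ⟩ := hH
    let χ := ψ.trans φ
    refine ⟨by simpa using he, ?_, ?_⟩
    · rw [← Nat.card_coe_set_eq, ← Nat.card_congr χ.toEquiv, Nat.card_fin]
    · intro x hx y hy hxy
      obtain ⟨i, hi⟩ := χ.surjective ⟨x, hx⟩
      obtain ⟨j, hj⟩ := χ.surjective ⟨y, hy⟩
      have hij : i ≠ j := by
        rintro rfl
        exact hxy (congrArg Subtype.val (hi.symm.trans hj))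
      have : K.coe.Adj (χ i) (χ j) := χ.map_rel_iff.2 hij
      rw [hi, hj] at this
      exact this
  rw [hN]
  refine le_trans ?_ (Nat.choose_le_pow N.card (k - 2))
  rw [← Finset.card_powersetCard, ← Set.ncard_coe_finset]
  refine Set.ncard_le_ncard_of_injOn (fun K => (K.verts \ {u, v}).toFinset) ?_ ?_ (Set.toFinite _)
  · intro K hK
    obtain ⟨hKuv, hKc, hKa⟩ := key K hK
    have hsub : ({u, v} : Set V) ⊆ K.verts := by
      rintro x (rfl | rfl)
      · exact hKuv.fst_mem
      · exact hKuv.snd_mem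
    rw [Finset.mem_coe, Finset.mem_powersetCard]
    constructor
    · intro x hx
      rw [Set.mem_toFinset] at hx
      have h1 : x ≠ u := fun h => hx.2 (by simp [h])
      have h2 : x ≠ v := fun h => hx.2 (by simp [h])
      rw [Set.mem_toFinset]
      exact ⟨(hKa u hKuv.fst_mem x hx.1 h1.symm).adj_sub,
        (hKa v hKuv.snd_mem x hx.1 h2.symm).adj_sub⟩
    · rw [← Set.ncard_eq_toFinset_card', Set.ncard_sdiff hsub, hKc, Set.ncard_pair huv.ne]
  · intro K hK K' hK' h
    obtain ⟨hKuv, -, hKa⟩ := key K hK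
    obtain ⟨hKuv', -, hKa'⟩ := key K' hK'
    have hv : ∀ x, x ∈ K.verts ↔ x ∈ K'.verts := by
      intro x
      by_cases hx : x = u ∨ x = v
      · rcases hx with rfl | rfl
        · simp [hKuv.fst_mem, hKuv'.fst_mem]
        · simp [hKuv.snd_mem, hKuv'.snd_mem]
      · have := congrArg (fun S => x ∈ S) h
        simpa [hx] using this
    apply SimpleGraph.Subgraph.ext
    · exact Set.ext hv
    · ext x y
      constructor
      · intro h
        exact hKa' x ((hv x).1 h.fst_mem) y ((hv y).1 h.snd_mem) h.adj_sub.ne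
      · intro h
        exact hKa x ((hv x).2 h.fst_mem) y ((hv y).2 h.snd_mem) h.adj_sub.ne

/-- The lower bound for a single locally dense graph. -/
lemma two_pow_le_subdivisionCount_of_isLocallyDense [Fintype V] {k ℓ t p : ℕ} (hk : 3 ≤ k)
    (hkℓ : k ≤ ℓ) (ht : 0 < t) (hp : ∀ c : ℕ, t ≤ c ^ (k - 2) → ℓ + 2 * p ≤ c)
    {F : SimpleGraph (Fin ℓ)} (hF : (⊤ : SimpleGraph (Fin k)).IsContained F)
    {G : SimpleGraph V} (hG : G.edgeSet.Nonempty) (hd : IsLocallyDense F k t G) :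
    2 ^ p ≤ subdivisionCount F G := by
  obtain ⟨g⟩ := hF
  have h01 : F.Adj (g ⟨0, by omega⟩) (g ⟨1, by omega⟩) := g.toHom.map_adj (by simp)
  obtain ⟨e, he⟩ := hG
  have hcopy : Nonempty (SimpleGraph.Copy F G) := by
    have h := hd ⊤ (by simpa using hkℓ) ⟨s(_, _), by simpa using h01⟩ e he
    obtain ⟨K, -, ⟨φ⟩⟩ := Set.nonempty_of_ncard_ne_zero (ht.trans_le h).ne'
    exact ⟨K.coeCopy.comp (φ.toCopy.comp SimpleGraph.Subgraph.topIso.symm.toCopy)⟩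
  obtain ⟨f⟩ := hcopy
  refine two_pow_le_subdivisionCount f h01 p ?_
  intro u v huv
  rw [Fintype.card_fin]
  apply hp
  refine le_trans (hd g.toSubgraph ?_ ?_ s(u, v) huv)
    (ncard_copiesThrough_le ⟨g.isoToSubgraph⟩ huv)
  · rw [← Nat.card_coe_set_eq, ← Nat.card_congr g.isoToSubgraph.toEquiv, Nat.card_fin]
  · exact ⟨s(g ⟨0, by omega⟩, g ⟨1, by omega⟩), by
      refine ⟨⟨0, by omega⟩, ⟨1, by omega⟩, ?_, rfl, rfl⟩
      simp⟩

/-- The numerical estimate behind the exponent `1 / (2 * (k - 2))`: if `t ≤ c ^ (k - 2)`, then `c`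
is at least the square of `t ^ (1 / (2 * (k - 2)))`, which leaves room for `ℓ` and for the linear
loss of `exists_path_supports`. -/
lemma eventually_exists_exponent (k ℓ : ℕ) (hk : 3 ≤ k) :
    ∀ᶠ t : ℕ in atTop, 0 < t ∧ ∃ p : ℕ, (t : ℝ) ^ (1 / (2 * ((k : ℝ) - 2))) ≤ p ∧
      ∀ c : ℕ, t ≤ c ^ (k - 2) → ℓ + 2 * p ≤ c := by
  obtain ⟨m, rfl⟩ : ∃ m, k = m + 3 := ⟨k - 3, by omega⟩
  have hα : (0 : ℝ) < 1 / (2 * (((m + 3 : ℕ) : ℝ) - 2)) := by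
    apply one_div_pos.2
    push_cast
    have : (0 : ℝ) ≤ m := Nat.cast_nonneg m
    linarith
  have hlim := (tendsto_rpow_atTop hα).comp tendsto_natCast_atTop_atTop
  filter_upwards [hlim.eventually_ge_atTop ((ℓ : ℝ) + 4), eventually_gt_atTop 0] with t ht ht0
  refine ⟨ht0, ?_⟩
  simp only [Function.comp_apply] at ht
  set r : ℝ := (t : ℝ) ^ (1 / (2 * (((m + 3 : ℕ) : ℝ) - 2))) with hr
  refine ⟨⌈r⌉₊, Nat.le_ceil r, ?_⟩
  intro c hc
  have hr0 : 0 ≤ r := by positivity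
  have hrt : r ^ (2 * (m + 1)) = t := by
    rw [hr, ← Real.rpow_natCast, ← Real.rpow_mul (by positivity)]
    have : 1 / (2 * (((m + 3 : ℕ) : ℝ) - 2)) * ((2 * (m + 1) : ℕ) : ℝ) = 1 := by
      push_cast
      have h1 : (m : ℝ) + 1 ≠ 0 := by positivity
      have h2 : (m : ℝ) + 3 - 2 = m + 1 := by ring
      rw [h2]
      field_simp
    rw [this, Real.rpow_one]
  have hrc : r ^ 2 ≤ c := by
    have h1 : (r ^ 2) ^ (m + 1) ≤ (c : ℝ) ^ (m + 1) := by
      rw [← pow_mul, hrt]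
      exact_mod_cast hc
    exact le_of_pow_le_pow_left₀ (Nat.succ_ne_zero m) (Nat.cast_nonneg c) h1
  have hceil : (⌈r⌉₊ : ℝ) < r + 1 := Nat.ceil_lt_add_one hr0
  have hfin : ((ℓ + 2 * ⌈r⌉₊ : ℕ) : ℝ) ≤ (c : ℝ) := by
    push_cast
    have hℓ : (0 : ℝ) ≤ ℓ := Nat.cast_nonneg ℓ
    nlinarith
  exact_mod_cast hfin

/-! ### Families of copies that differ in one vertex -/

/-- Moving the image of the single vertex `z` to each of the unused vertices in `S` gives `S.card`
copies of `H` through a fixed edge, because their vertex sets are distinct. -/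
lemma card_le_ncard_copiesThrough [Finite V] [DecidableEq W] {H : SimpleGraph W}
    {G : SimpleGraph V} (g : W → V) (hg : g.Injective) (z : W) (S : Finset V)
    (hS : ∀ c ∈ S, c ∉ Set.range g)
    (hom : ∀ c ∈ S, ∀ x y, H.Adj x y → G.Adj (Function.update g z c x) (Function.update g z c y))
    {x y : W} (hxy : H.Adj x y) (hx : x ≠ z) (hy : y ≠ z) :
    S.card ≤ (copiesThrough H G s(g x, g y)).ncard := by
  have hinj : ∀ c ∈ S, (Function.update g z c).Injective := by
    intro c hc a b hab
    by_cases ha : a = z <;> by_cases hb : b = z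
    · rw [ha, hb]
    · subst ha
      rw [Function.update_self, Function.update_of_ne hb] at hab
      exact absurd ⟨b, hab.symm⟩ (hS c hc)
    · subst hb
      rw [Function.update_self, Function.update_of_ne ha] at hab
      exact absurd ⟨a, hab⟩ (hS c hc)
    · rw [Function.update_of_ne ha, Function.update_of_ne hb] at hab
      exact hg hab
  have hex : ∀ c ∈ S, ∃ K ∈ copiesThrough H G s(g x, g y),
      K.verts = Set.range (Function.update g z c) := by
    intro c hc
    let f : SimpleGraph.Copy H G := ⟨⟨Function.update g z c, fun {a b} h => hom c hc a b h⟩,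
      hinj c hc⟩
    have hv : f.toSubgraph.verts = Set.range (Function.update g z c) := by
      ext a
      simp [SimpleGraph.Copy.toSubgraph, f]
    refine ⟨f.toSubgraph, ⟨?_, ⟨f.isoToSubgraph⟩⟩, hv⟩
    refine ⟨x, y, hxy, ?_, ?_⟩
    · exact Function.update_of_ne hx _ _
    · exact Function.update_of_ne hy _ _
  choose! K hK hKv using hex
  rw [← Set.ncard_coe_finset]
  refine Set.ncard_le_ncard_of_injOn K (fun c hc => hK c hc) ?_ (Set.toFinite _)
  intro c hc c' hc' h
  have hmem : c ∈ (K c').verts := by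
    rw [← h, hKv c hc]
    exact ⟨z, Function.update_self ..⟩
  rw [hKv c' hc'] at hmem
  obtain ⟨a, ha⟩ := hmem
  by_cases haz : a = z
  · subst haz
    rw [Function.update_self] at ha
    exact ha.symm
  · rw [Function.update_of_ne haz] at ha
    exact absurd ⟨a, ha⟩ (hS c hc)

lemma exists_perm_of_ne {α : Type*} [DecidableEq α] {x y a b : α} (hxy : x ≠ y) (hab : a ≠ b) :
    ∃ σ : Equiv.Perm α, σ x = a ∧ σ y = b := by
  refine ⟨(Equiv.swap x a).trans (Equiv.swap (Equiv.swap x a y) b), ?_, ?_⟩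
  · have h : a ≠ Equiv.swap x a y := by
      intro h
      exact hxy ((Equiv.swap x a).injective ((Equiv.swap_apply_left x a).trans h))
    simp [Equiv.swap_apply_of_ne_of_ne h hab]
  · simp

lemma exists_ne_ne_of_three_le_card [Finite W] (h : 3 ≤ Nat.card W) (x y : W) :
    ∃ z, z ≠ x ∧ z ≠ y := by
  classical
  have := Fintype.ofFinite W
  rw [Nat.card_eq_fintype_card] at h
  have h2 : ({x, y} : Finset W).card < Fintype.card W := lt_of_le_of_lt Finset.card_le_two h
  obtain ⟨z, hz⟩ := Finset.exists_mem_notMem_of_card_lt_card (s := {x, y}) (t := Finset.univ)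
    (by simpa using h2)
  exact ⟨z, by simpa using hz.2⟩

/-! ### Existence of locally dense graphs -/

lemma isLocallyDense_top {k ℓ : ℕ} (hk : 3 ≤ k) (t : ℕ) (F : SimpleGraph (Fin ℓ)) :
    IsLocallyDense F k t (⊤ : SimpleGraph (Fin (ℓ + t))) := by
  classical
  intro F' hF' hne e he
  obtain ⟨e', he'⟩ := hne
  induction e' with | h x y
  induction e with | h a b
  have hxy : F'.Adj x y := he'
  have hab : a ≠ b := he
  obtain ⟨z, hzx, hzy⟩ := exists_ne_ne_of_three_le_card
    (W := F'.verts) (by rw [Nat.card_coe_set_eq]; omega) ⟨x, hxy.fst_mem⟩ ⟨y, hxy.snd_mem⟩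
  obtain ⟨σ, hσx, hσy⟩ := exists_perm_of_ne (x := Fin.castAdd t x) (y := Fin.castAdd t y)
    (by simpa using hxy.ne) hab
  let g : F'.verts → Fin (ℓ + t) := fun w => σ (Fin.castAdd t w)
  have hg : g.Injective := by
    intro w w' h
    simpa [g, Subtype.ext_iff] using h
  let S : Finset (Fin (ℓ + t)) := Finset.univ.image (fun i : Fin t => σ (Fin.natAdd ℓ i))
  have hSc : S.card = t := by
    rw [Finset.card_image_of_injective, Finset.card_univ, Fintype.card_fin]
    intro i j h
    simpa using h
  have hSg : ∀ c ∈ S, c ∉ Set.range g := by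
    intro c hc
    obtain ⟨i, -, rfl⟩ := Finset.mem_image.1 hc
    rintro ⟨w, hw⟩
    have := congrArg Fin.val (σ.injective hw)
    simp only [Fin.val_castAdd, Fin.val_natAdd] at this
    omega
  have := card_le_ncard_copiesThrough (H := F'.coe) (G := ⊤) g hg z S hSg ?_
    (x := ⟨x, hxy.fst_mem⟩) (y := ⟨y, hxy.snd_mem⟩) hxy hzx.symm hzy.symm
  · rw [hSc] at this
    simpa [g, hσx, hσy] using this
  · intro c hc p q hpq
    rw [SimpleGraph.top_adj]
    have hne : p ≠ q := hpq.ne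
    by_cases hp : p = z <;> by_cases hq : q = z
    · exact absurd (hp.trans hq.symm) hne
    · subst hp
      rw [Function.update_self, Function.update_of_ne hq]
      exact fun h => hSg c hc ⟨q, h.symm⟩
    · subst hq
      rw [Function.update_self, Function.update_of_ne hp]
      exact fun h => hSg c hc ⟨p, h⟩
    · rw [Function.update_of_ne hp, Function.update_of_ne hq]
      exact fun h => hne (hg h)

/-! ### A sparse locally dense graph for `K_k`-free `F` -/

/-- The join of a clique on the first `ℓ` vertices and an independent set on the other vertices. -/
def cliqueJoinIndep (ℓ n : ℕ) : SimpleGraph (Fin n) where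
  Adj x y := x ≠ y ∧ (x.val < ℓ ∨ y.val < ℓ)
  symm := ⟨fun _ _ h => ⟨h.1.symm, h.2.symm⟩⟩
  loopless := ⟨fun _ h => h.1 rfl⟩

/-- A graph with an edge in which every non-isolated vertex is adjacent to all others is complete,
so a `K_k`-free graph with an edge and at least `k` vertices has a non-isolated vertex with a
non-neighbour. -/
lemma exists_adj_not_adj [Finite W] {k : ℕ} {H : SimpleGraph W} (hk : k ≤ Nat.card W)
    (hH : ¬ (⊤ : SimpleGraph (Fin k)).IsContained H) {x₀ y₀ : W} (h₀ : H.Adj x₀ y₀) :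
    ∃ x y w, H.Adj x w ∧ x ≠ y ∧ ¬ H.Adj x y := by
  by_contra! hcon
  apply hH
  have hx₀ : ∀ y, x₀ ≠ y → H.Adj x₀ y := fun y hy => hcon x₀ y y₀ h₀ hy
  have hall : ∀ x y, x ≠ y → H.Adj x y := by
    intro x y hxy
    by_cases h : x₀ = x
    · exact h ▸ hx₀ y (h ▸ hxy)
    · exact hcon x y x₀ (hx₀ x h).symm hxy
  let f : Fin k → W := fun i => (Finite.equivFin W).symm (Fin.castLE hk i)
  have hf : f.Injective := fun i j h => by simpa [f] using h
  exact ⟨⟨⟨f, fun {i j} h => hall _ _ (hf.ne h.ne)⟩, hf⟩⟩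

lemma isLocallyDense_cliqueJoinIndep {k ℓ : ℕ} (hk : 3 ≤ k) (t : ℕ) (F : SimpleGraph (Fin ℓ))
    (hF : F.CliqueFree k) : IsLocallyDense F k t (cliqueJoinIndep ℓ (ℓ + (t + 1))) := by
  classical
  intro F' hF' hne e he
  obtain ⟨e', he'⟩ := hne
  induction e' with | h x₀ y₀
  obtain ⟨x, y, hxy₀⟩ : ∃ x y, F'.coe.Adj x y :=
    have h : F'.Adj x₀ y₀ := he'
    ⟨⟨x₀, h.fst_mem⟩, ⟨y₀, h.snd_mem⟩, h⟩
  have hcard : k ≤ Nat.card F'.verts := by rwa [Nat.card_coe_set_eq]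
  have hfree : ¬ (⊤ : SimpleGraph (Fin k)).IsContained F'.coe := by
    intro h
    have h' := h.trans (SimpleGraph.Subgraph.coe_isContained F')
    exact (SimpleGraph.cliqueFree_iff.1 hF).false h'.some
  -- By symmetry only the first end of the edge needs to lie in the clique.
  suffices main : ∀ a b : Fin (ℓ + (t + 1)), a ≠ b → a.val < ℓ →
      t ≤ (copiesThrough F'.coe (cliqueJoinIndep ℓ (ℓ + (t + 1))) s(a, b)).ncard by
    induction e with | h a b
    obtain ⟨hab, h | h⟩ : a ≠ b ∧ (a.val < ℓ ∨ b.val < ℓ) := he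
    · exact main a b hab h
    · rw [Sym2.eq_swap]
      exact main b a hab.symm h
  intro a b hab ha
  let emb : Fin ℓ → Fin (ℓ + (t + 1)) := Fin.castAdd (t + 1)
  have hemb : emb.Injective := Fin.castAdd_injective _ _
  obtain ⟨a, rfl⟩ : ∃ a', emb a' = a := ⟨⟨a, ha⟩, rfl⟩
  let B : Finset (Fin (ℓ + (t + 1))) := Finset.univ.image (Fin.natAdd ℓ)
  have hBc : B.card = t + 1 := by
    rw [Finset.card_image_of_injective _ (Fin.natAdd_injective _ _), Finset.card_univ,
      Fintype.card_fin]
  have hB : ∀ c ∈ B, ℓ ≤ c.val := by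
    intro c hc
    obtain ⟨i, -, rfl⟩ := Finset.mem_image.1 hc
    simp
  have hembB : ∀ c ∈ B, ∀ i, emb i ≠ c := by
    rintro c hc i rfl
    have h1 := hB _ hc
    have h2 : (emb i).val = i.val := rfl
    omega
  by_cases hb : b.val < ℓ
  · -- Both ends lie in the clique: a third vertex of `F'` moves through the independent set.
    obtain ⟨b, rfl⟩ : ∃ b', emb b' = b := ⟨⟨b, hb⟩, rfl⟩
    obtain ⟨z, hzx, hzy⟩ := exists_ne_ne_of_three_le_card (hk.trans hcard) x y
    obtain ⟨σ, hσx, hσy⟩ := exists_perm_of_ne (x := x.val) (y := y.val) (a := a) (b := b)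
      (fun h => hxy₀.ne (Subtype.ext h)) (fun h => hab (by rw [h]))
    let g : F'.verts → Fin (ℓ + (t + 1)) := fun w => emb (σ w)
    have hg : g.Injective := fun w w' h => Subtype.ext (σ.injective (hemb h))
    have := card_le_ncard_copiesThrough (G := cliqueJoinIndep ℓ (ℓ + (t + 1))) g hg z B
      (by rintro c hc ⟨w, hw⟩; exact hembB c hc _ hw) ?_ hxy₀ hzx.symm hzy.symm
    · simp only [g, hσx, hσy] at this
      omega
    · intro c hc p q hpq
      by_cases hp : p = z
      · subst hp
        rw [Function.update_self, Function.update_of_ne hpq.ne']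
        exact ⟨(hembB c hc _).symm, Or.inr (σ q).isLt⟩
      · rw [Function.update_of_ne hp]
        refine ⟨?_, Or.inl (σ p).isLt⟩
        by_cases hq : q = z
        · subst hq
          rw [Function.update_self]
          exact hembB c hc _
        · rw [Function.update_of_ne hq]
          exact fun h => hpq.ne (hg h)
  · -- One end lies in the independent set: it is the image of a non-isolated vertex `x`, and a
    -- non-neighbour `y` of `x` moves through the rest of the independent set.
    obtain ⟨x, y, w, hxw, hxy, hnadj⟩ := exists_adj_not_adj hcard hfree hxy₀
    have hwy : w ≠ y := by rintro rfl; exact hnadj hxw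
    let σ := Equiv.swap w.val a
    have hσw : σ w.val = a := Equiv.swap_apply_left _ _
    have hbB : b ∈ B := by
      refine Finset.mem_image.2 ⟨⟨b.val - ℓ, by omega⟩, Finset.mem_univ _, ?_⟩
      ext
      simp only [Fin.val_natAdd]
      omega
    let g₀ : F'.verts → Fin (ℓ + (t + 1)) := fun w => emb (σ w)
    have hg₀ : g₀.Injective := fun w w' h => Subtype.ext (σ.injective (hemb h))
    let g := Function.update g₀ x b
    have hgx : g x = b := Function.update_self ..
    have hgne : ∀ q, q ≠ x → g q = emb (σ q) := fun q hq => Function.update_of_ne hq _ _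
    have hg : g.Injective := by
      intro p q h
      by_cases hp : p = x <;> by_cases hq : q = x
      · rw [hp, hq]
      · subst hp
        rw [hgx, hgne q hq] at h
        exact absurd h.symm (hembB b hbB _)
      · subst hq
        rw [hgx, hgne p hp] at h
        exact absurd h (hembB b hbB _)
      · rw [hgne p hp, hgne q hq] at h
        exact hg₀ h
    have hSg : ∀ c ∈ B.erase b, c ∉ Set.range g := by
      rintro c hc ⟨q, hq⟩
      rw [Finset.mem_erase] at hc
      by_cases h : q = x
      · subst h
        exact hc.1 (hq.symm.trans hgx)
      · rw [hgne q h] at hq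
        exact hembB c hc.2 _ hq
    have := card_le_ncard_copiesThrough (G := cliqueJoinIndep ℓ (ℓ + (t + 1))) g hg y (B.erase b)
      hSg ?_ hxw.symm hwy hxy
    · rw [Finset.card_erase_of_mem hbB, hBc, hgx, hgne w hxw.ne', hσw] at this
      simpa using this
    · have hlow : ∀ c ∈ B.erase b, ∀ q, q ≠ x → q ≠ y →
          (Function.update g y c q).val < ℓ := by
        intro c _ q hqx hqy
        rw [Function.update_of_ne hqy, hgne q hqx]
        exact (σ q).isLt
      intro c hc p q hpq
      constructor
      · by_cases hp : p = y
        · subst hp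
          rw [Function.update_self, Function.update_of_ne hpq.ne']
          exact fun h => hSg c hc ⟨q, h.symm⟩
        · rw [Function.update_of_ne hp]
          by_cases hq : q = y
          · subst hq
            rw [Function.update_self]
            exact fun h => hSg c hc ⟨p, h⟩
          · rw [Function.update_of_ne hq]
            exact fun h => hpq.ne (hg h)
      · by_cases hp : p ≠ x ∧ p ≠ y
        · exact Or.inl (hlow c hc p hp.1 hp.2)
        · refine Or.inr (hlow c hc q ?_ ?_)
          · rintro rfl
            by_cases hpy : p = y
            · subst hpy; exact hnadj hpq.symm
            · exact hp ⟨hpq.ne, hpy⟩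
          · rintro rfl
            by_cases hpx : p = x
            · subst hpx; exact hnadj hpq
            · exact hp ⟨hpx, hpq.ne⟩

/-! ### Few subdivisions next to a small vertex cover -/

/-- Two consecutive entries outside a vertex cover do not occur, so entries outside the cover
exceed those inside by at most one. -/
lemma countP_not_le_of_isChain (c : V → Prop) [DecidablePred c] :
    ∀ l : List V, l.IsChain (fun x y => c x ∨ c y) →
      l.countP (fun x => ¬ c x) ≤ l.countP (fun x => c x) + 1
  | [], _ => by simp
  | [x], _ => by by_cases h : c x <;> simp [h]
  | x :: y :: l, h => by
    rw [List.isChain_cons_cons] at h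
    by_cases hx : c x
    · have ih := countP_not_le_of_isChain c (y :: l) h.2
      rw [List.countP_cons, List.countP_cons (l := y :: l)]
      simp only [hx, not_true_eq_false, decide_false, decide_true, if_true]
      simp only [Bool.false_eq_true, if_false]
      omega
    · have hy : c y := h.1.resolve_left hx
      have ih := countP_not_le_of_isChain c l h.2.tail
      simp only [List.countP_cons, hx, hy, not_true_eq_false, not_false_eq_true, decide_false,
        decide_true, if_true, Bool.false_eq_true, if_false]
      omega

lemma mem_support_tail_dropLast {G : SimpleGraph V} {u v : V} (q : G.Walk u v) (hq : q.IsPath)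
    (huv : u ≠ v) (x : V) :
    x ∈ q.support.tail.dropLast ↔ x ∈ q.support ∧ x ≠ u ∧ x ≠ v := by
  cases q with
  | nil => exact absurd rfl huv
  | cons h r =>
    rw [SimpleGraph.Walk.cons_isPath_iff] at hq
    have hr : r.support.dropLast ++ [v] = r.support := by
      conv_rhs => rw [← List.dropLast_append_getLast r.support_ne_nil]
      rw [SimpleGraph.Walk.getLast_support]
    have hnd := hq.1.support_nodup
    have hu := hq.2
    rw [SimpleGraph.Walk.support_cons, List.tail_cons]
    rw [← hr] at hnd hu ⊢
    rw [List.dropLast_concat]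
    clear hr
    generalize r.support.dropLast = d at *
    have hd := List.nodup_append.1 hnd
    constructor
    · intro hx
      refine ⟨by simp [hx], ?_, ?_⟩
      · rintro rfl; exact hu (by simp [hx])
      · rintro rfl; exact hd.2.2 x hx x (by simp) rfl
    · rintro ⟨hx, hxu, hxv⟩
      simpa [hxu, hxv] using hx

/-- If `c` is a vertex cover of `G`, every subdivision of `F` in `G` has a bounded number of
vertices outside the cover: branch vertices, and on each subdivided edge at most one more interior
vertex outside the cover than inside. -/
lemma ncard_verts_not_cover_le [Fintype V] [Fintype W] {F : SimpleGraph W} {G : SimpleGraph V}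
    (c : V → Prop) (hc : ∀ x y, G.Adj x y → c x ∨ c y) {T : G.Subgraph} (hT : IsSubdivision F T) :
    {x | x ∈ T.verts ∧ ¬ c x}.ncard ≤ F.edgeSet.ncard + (Fintype.card W + {x | c x}.ncard) := by
  classical
  obtain ⟨b, P, hPath, hrev, hends, hdisj, hverts, -⟩ := hT
  let I : Sym2 W → Finset V := fun e => Finset.univ.filter fun x => x ∉ Set.range b ∧
    ∃ u v, ∃ h : F.Adj u v, s(u, v) = e ∧ x ∈ (P u v h).support
  have hI : ∀ e ∈ F.edgeFinset,
      ((I e).filter (fun x => ¬ c x)).card ≤ ((I e).filter c).card + 1 := by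
    intro e he
    induction e with | h u v
    have h : F.Adj u v := by simpa using he
    let l := (P u v h).support.tail.dropLast
    have hl : l.Nodup := (hPath u v h).support_nodup.tail.sublist (List.dropLast_sublist _)
    have hIl : I s(u, v) = l.toFinset := by
      ext x
      rw [List.mem_toFinset, mem_support_tail_dropLast _ (hPath u v h) (b.injective.ne h.ne)]
      simp only [I, Finset.mem_filter, Finset.mem_univ, true_and]
      constructor
      · rintro ⟨hxb, u', v', h', he', hx⟩
        refine ⟨?_, fun h => hxb ⟨u, h.symm⟩, fun h => hxb ⟨v, h.symm⟩⟩
        rcases Sym2.eq_iff.1 he' with ⟨rfl, rfl⟩ | ⟨rfl, rfl⟩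
        · exact hx
        · rw [hrev] at hx
          simpa using hx
      · rintro ⟨hx, hxu, hxv⟩
        refine ⟨?_, u, v, h, rfl, hx⟩
        rintro ⟨w, rfl⟩
        rcases hends u v h w hx with rfl | rfl
        · exact hxu rfl
        · exact hxv rfl
    have hcnt : ∀ (d : V → Prop) [DecidablePred d],
        ((I s(u, v)).filter d).card = l.countP (fun x => d x) := by
      intro d _
      have hfil : l.toFinset.filter d = (l.filter (fun x => d x)).toFinset := by
        ext; simp
      rw [hIl, hfil, List.toFinset_card_of_nodup (hl.filter _),
        List.countP_eq_length_filter]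
    rw [hcnt, hcnt]
    apply countP_not_le_of_isChain
    have hch : (P u v h).support.IsChain (fun x y => c x ∨ c y) :=
      (P u v h).isChain_adj_support.imp (fun x y => hc x y)
    exact hch.tail.dropLast
  have hIdisj : ∀ e e', e ≠ e' → Disjoint ((I e).filter c) ((I e').filter c) := by
    intro e e' hne
    rw [Finset.disjoint_left]
    intro x hx hx'
    simp only [I, Finset.mem_filter, Finset.mem_univ, true_and] at hx hx'
    obtain ⟨⟨hxb, u, v, h, rfl, hxu⟩, -⟩ := hx
    obtain ⟨⟨-, u', v', h', rfl, hxu'⟩, -⟩ := hx'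
    exact hxb (hdisj u v h u' v' h' hne x hxu hxu')
  have hsub : {x | x ∈ T.verts ∧ ¬ c x} ⊆ ((Finset.univ.image b ∪
      F.edgeFinset.biUnion (fun e => (I e).filter (fun x => ¬ c x)) : Finset V) : Set V) := by
    rintro x ⟨hx, hxc⟩
    rw [Finset.mem_coe, Finset.mem_union]
    by_cases hxb : x ∈ Set.range b
    · obtain ⟨w, rfl⟩ := hxb
      exact Or.inl (Finset.mem_image_of_mem _ (Finset.mem_univ w))
    · obtain ⟨u, v, h, hxu⟩ := ((hverts x).1 hx).resolve_left hxb
      refine Or.inr (Finset.mem_biUnion.2 ⟨s(u, v), by simpa using h, ?_⟩)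
      simp only [I, Finset.mem_filter, Finset.mem_univ, true_and]
      exact ⟨⟨hxb, u, v, h, rfl, hxu⟩, hxc⟩
  have hin : (F.edgeFinset.biUnion (fun e => (I e).filter c)).card ≤ {x | c x}.ncard := by
    rw [← Set.ncard_coe_finset]
    refine Set.ncard_le_ncard ?_ (Set.toFinite _)
    intro x hx
    simp only [Finset.coe_biUnion, Set.mem_iUnion, Finset.mem_coe, Finset.mem_filter] at hx
    obtain ⟨e, -, -, h⟩ := hx
    exact h
  rw [Finset.card_biUnion (fun e _ e' _ hne => hIdisj e e' hne)] at hin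
  calc {x | x ∈ T.verts ∧ ¬ c x}.ncard
      ≤ (Finset.univ.image b ∪
          F.edgeFinset.biUnion (fun e => (I e).filter (fun x => ¬ c x))).card := by
        rw [← Set.ncard_coe_finset]
        exact Set.ncard_le_ncard hsub (Set.toFinite _)
    _ ≤ Fintype.card W + ∑ e ∈ F.edgeFinset, ((I e).filter (fun x => ¬ c x)).card :=
        (Finset.card_union_le _ _).trans (add_le_add Finset.card_image_le Finset.card_biUnion_le)
    _ ≤ Fintype.card W + ∑ e ∈ F.edgeFinset, (((I e).filter c).card + 1) := by
        gcongr with e he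
        exact hI e he
    _ ≤ F.edgeSet.ncard + (Fintype.card W + {x | c x}.ncard) := by
        rw [Finset.sum_add_distrib, Finset.sum_const, smul_eq_mul, mul_one,
          ← SimpleGraph.coe_edgeFinset, Set.ncard_coe_finset]
        omega

/-- Subsets of `B` with at most `N` elements are the ranges of partial functions from `Fin N`. -/
lemma card_le_pow_of_card_le [DecidableEq V] (B : Finset V) (N : ℕ) (D : Finset (Finset V))
    (hD : ∀ Y ∈ D, Y ⊆ B ∧ Y.card ≤ N) : D.card ≤ (B.card + 1) ^ N := by
  let r : (Fin N → Option B) → Finset V := fun f =>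
    B.filter fun x => ∃ i, ∃ h : x ∈ B, f i = some ⟨x, h⟩
  have hsub : D ⊆ Finset.univ.image r := by
    intro Y hY
    obtain ⟨hYB, hYN⟩ := hD Y hY
    refine Finset.mem_image.2 ⟨fun i => if h : i.val < Y.card then
      some ⟨Y.equivFin.symm ⟨i, h⟩, hYB (Y.equivFin.symm ⟨i, h⟩).2⟩ else none,
      Finset.mem_univ _, ?_⟩
    ext x
    simp only [r, Finset.mem_filter]
    constructor
    · rintro ⟨-, i, hx, hi⟩
      split_ifs at hi with h
      have heq : (Y.equivFin.symm ⟨i, h⟩ : V) = x := congrArg Subtype.val (Option.some.inj hi)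
      exact heq ▸ (Y.equivFin.symm ⟨i, h⟩).2
    · intro hx
      refine ⟨hYB hx, ⟨Y.equivFin ⟨x, hx⟩, (Y.equivFin ⟨x, hx⟩).isLt.trans_le hYN⟩, hYB hx, ?_⟩
      simp
  calc D.card ≤ (Finset.univ.image r).card := Finset.card_le_card hsub
    _ ≤ (Finset.univ : Finset (Fin N → Option B)).card := Finset.card_image_le
    _ = (B.card + 1) ^ N := by simp

/-- A graph with a vertex cover `A` has few vertex sets of subdivisions of `F`: such a set is
determined by its trace on `A` and by its bounded number of vertices outside `A`. -/
lemma subdivisionCount_le_of_cover [Fintype V] [Fintype W] [DecidableEq V] {F : SimpleGraph W}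
    {G : SimpleGraph V} (A : Finset V) (hA : ∀ x y, G.Adj x y → x ∈ A ∨ y ∈ A) :
    subdivisionCount F G ≤
      2 ^ A.card * (Aᶜ.card + 1) ^ (F.edgeSet.ncard + (Fintype.card W + A.card)) := by
  classical
  apply csSup_le'
  rintro n ⟨C, hC, hd, rfl⟩
  set N := F.edgeSet.ncard + (Fintype.card W + A.card)
  let φ : G.Subgraph → Finset V × Finset V := fun T =>
    (A.filter (· ∈ T.verts), Aᶜ.filter (· ∈ T.verts))
  have hφ : Set.InjOn φ C := by
    intro T hT T' hT' h
    by_contra hne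
    refine hd hT hT' hne (Set.ext fun x => ?_)
    rw [Prod.ext_iff] at h
    by_cases hx : x ∈ A
    · simpa [φ, hx] using congrArg (x ∈ ·) h.1
    · simpa [φ, hx] using congrArg (x ∈ ·) h.2
  have hsmall : ∀ Y ∈ C.image (fun T => (φ T).2), Y ⊆ Aᶜ ∧ Y.card ≤ N := by
    intro Y hY
    obtain ⟨T, hT, rfl⟩ := Finset.mem_image.1 hY
    refine ⟨Finset.filter_subset _ _, ?_⟩
    have := ncard_verts_not_cover_le (· ∈ A) hA (hC T hT)
    have hAn : {x | x ∈ A}.ncard = A.card := Set.ncard_coe_finset A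
    rw [hAn] at this
    refine le_of_eq_of_le ?_ this
    rw [← Set.ncard_coe_finset]
    congr 1
    ext x
    simp [φ, and_comm]
  calc C.card = (C.image φ).card := (Finset.card_image_of_injOn hφ).symm
    _ ≤ (A.powerset ×ˢ C.image (fun T => (φ T).2)).card := by
        apply Finset.card_le_card
        intro q hq
        obtain ⟨T, hT, rfl⟩ := Finset.mem_image.1 hq
        exact Finset.mem_product.2 ⟨Finset.mem_powerset.2 (Finset.filter_subset _ _),
          Finset.mem_image.2 ⟨T, hT, rfl⟩⟩
    _ ≤ 2 ^ A.card * (Aᶜ.card + 1) ^ N := by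
        rw [Finset.card_product, Finset.card_powerset]
        exact Nat.mul_le_mul_left _ (card_le_pow_of_card_le _ _ _ hsmall)

lemma subdivisionCount_cliqueJoinIndep_le {ℓ : ℕ} (t : ℕ) (F : SimpleGraph (Fin ℓ)) :
    subdivisionCount F (cliqueJoinIndep ℓ (ℓ + (t + 1))) ≤
      2 ^ ℓ * (t + 2) ^ (F.edgeSet.ncard + 2 * ℓ) := by
  let A : Finset (Fin (ℓ + (t + 1))) := Finset.univ.image (Fin.castAdd (t + 1))
  have hAc : A.card = ℓ := by
    rw [Finset.card_image_of_injective _ (Fin.castAdd_injective _ _), Finset.card_univ,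
      Fintype.card_fin]
  have hA : ∀ x : Fin (ℓ + (t + 1)), x.val < ℓ → x ∈ A := fun x hx =>
    Finset.mem_image.2 ⟨⟨x, hx⟩, Finset.mem_univ _, rfl⟩
  have h := subdivisionCount_le_of_cover (F := F) (G := cliqueJoinIndep ℓ (ℓ + (t + 1))) A
    (fun x y hxy => hxy.2.imp (hA x) (hA y))
  rw [Finset.card_compl, hAc, Fintype.card_fin, Fintype.card_fin, Nat.add_sub_cancel_left] at h
  rwa [two_mul]

end LocallyDense

open LocallyDense in
theorem theorem6 :
    ∃ c' : ℕ → ℝ, (∀ k : ℕ, 3 ≤ k → 1 / (2 * ((k : ℝ) - 2)) ≤ c' k) ∧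
      ∀ k ℓ : ℕ, 3 ≤ k → k ≤ ℓ → ∀ᶠ t : ℕ in atTop, ∀ F : SimpleGraph (Fin ℓ),
        (subdivisionCounts F k t).Nonempty ∧
        ((⊤ : SimpleGraph (Fin k)).IsContained F →
          (2 : ℝ) ^ ((t : ℝ) ^ c' k) ≤ (minSubdivisionCount F k t : ℝ)) ∧
        (F.CliqueFree k →
          minSubdivisionCount F k t ≤ 2 ^ ℓ * (t + 2) ^ (F.edgeSet.ncard + 2 * ℓ)) := by
  refine ⟨fun k => 1 / (2 * ((k : ℝ) - 2)), fun k _ => le_rfl, ?_⟩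
  intro k ℓ hk hkℓ
  filter_upwards [eventually_exists_exponent k ℓ hk] with t ht F
  obtain ⟨ht0, p, hp, hpc⟩ := ht
  have hne : (subdivisionCounts F k t).Nonempty :=
    ⟨_, ℓ + t, ⊤, ⟨s(⟨0, by omega⟩, ⟨1, by omega⟩), by simp⟩, isLocallyDense_top hk t F, rfl⟩
  refine ⟨hne, fun hF => ?_, fun hF => ?_⟩
  · obtain ⟨n, G, hG, hd, hmin⟩ := Nat.sInf_mem hne
    have h := two_pow_le_subdivisionCount_of_isLocallyDense hk hkℓ ht0 hpc hF hG hd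
    have h' : (2 : ℝ) ^ p ≤ (minSubdivisionCount F k t : ℝ) := by
      rw [minSubdivisionCount, ← hmin]
      exact_mod_cast h
    refine le_trans ?_ h'
    rw [← Real.rpow_natCast]
    exact Real.rpow_le_rpow_of_exponent_le one_le_two hp
  · refine le_trans (Nat.sInf_le ?_) (subdivisionCount_cliqueJoinIndep_le t F)
    exact ⟨_, cliqueJoinIndep ℓ (ℓ + (t + 1)),
      ⟨s(⟨0, by omega⟩, ⟨1, by omega⟩), ⟨by simp, Or.inl (show 0 < ℓ by omega)⟩⟩,
      isLocallyDense_cliqueJoinIndep hk t F hF, rfl⟩
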